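/- For integers $d\ge 1$ and $n\ge 0$ let $T_d(n)=\{(x_1,\dots,x_d)\in\mathbb Z_{\ge 0}^d : x_1+\dots+x_d\le n-1\}\subset\mathbb R^d$ be the triangular grid. A fractional cover of $T_d(n)$ is an assignment of a nonnegative weight $w(H)$ to every affine hyperplane $H$ of $\mathbb R^d$ such that $\sum_{H\ni p}w(H)\ge 1$ for every $p\in T_d(n)$; let $f^*(n,d)$ be the minimum of the total weight $\sum_H w(H)$ over all fractional covers of $T_d(n)$. A $k$-cover of $T_d(n)$ is a multiset of affine hyperplanes of $\mathbb R^d$ such that every point of $T_d(n)$ lies on at least $k$ of them, counted with multiplicity; let $f(n,d,k)$ be the minimum cardinality (with multiplicity) of a $k$-cover of $T_d(n)$. **Proposition 2.5.** For every integer $k\ge 0$, $$f(n,2,k)\le f^*(k,2)\,n+O_k(1),$$ that is, there is a constant $C_k$ depending only on $k$ such that $f(n,2,k)\le f^*(k,2)\,n+C_k$ for all integers $n\ge 0$. -/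

import Mathlib

open scoped ENNReal NNReal

/-- The triangular grid `T_d(n)`: the points of `ℝ^d` with nonnegative integer coordinates
`x_1, …, x_d` such that `x_1 + ⋯ + x_d ≤ n - 1`. -/
def triGrid (d n : ℕ) : Set (Fin d → ℝ) :=
  {p | ∃ x : Fin d → ℕ, (∑ i, x i) + 1 ≤ n ∧ p = fun i => (x i : ℝ)}

/-- The affine hyperplanes of `ℝ^d`: the sets `{x | a_1 x_1 + ⋯ + a_d x_d = c}` with `a ≠ 0`.
For `d = 2` these are the lines of the plane. -/
def AffineHyperplane (d : ℕ) : Type :=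
  {H : Set (Fin d → ℝ) // ∃ a : Fin d → ℝ, a ≠ 0 ∧ ∃ c : ℝ, H = {x | ∑ i, a i * x i = c}}

/-- A weight assignment `w ≥ 0` on all affine hyperplanes of `ℝ^d` is a fractional cover of
`T_d(n)` if every grid point lies on hyperplanes of total weight at least `1`. The sums of
nonnegative terms are taken in `[0, ∞]`, where they always make sense. -/
def IsFractionalCover (n d : ℕ) (w : AffineHyperplane d → ℝ≥0) : Prop :=
  ∀ p ∈ triGrid d n, 1 ≤ ∑' H : {H : AffineHyperplane d // p ∈ H.1}, (w H.1 : ℝ≥0∞)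

/-- `f^*(n,d)` as an element of `[0, ∞]`: the smallest total weight of a fractional cover of
`T_d(n)`. -/
noncomputable def fracCoverENN (n d : ℕ) : ℝ≥0∞ :=
  ⨅ (w : AffineHyperplane d → ℝ≥0) (_ : IsFractionalCover n d w),
    ∑' H : AffineHyperplane d, (w H : ℝ≥0∞)

/-- `f^*(n,d)` as a real number (it is finite for `d ≥ 1`, see `fracCoverENN_ne_top`). -/
noncomputable def fracCoverNumber (n d : ℕ) : ℝ := (fracCoverENN n d).toReal

open Classical in
/-- A multiset of affine hyperplanes is a `k`-cover of `T_d(n)` if every grid point lies on at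
least `k` of its members, counted with multiplicity. -/
def IsKCover (n d k : ℕ) (C : Multiset (AffineHyperplane d)) : Prop :=
  ∀ p ∈ triGrid d n, k ≤ (C.filter (fun H => p ∈ H.1)).card

/-- `f(n,d,k)`: the minimum cardinality (with multiplicity) of a `k`-cover of `T_d(n)`; for
`d ≥ 1` a `k`-cover exists, see `exists_isKCover`. -/
noncomputable def kCoverNumber (n d k : ℕ) : ℕ :=
  sInf {m | ∃ C : Multiset (AffineHyperplane d), IsKCover n d k C ∧ C.card = m}

/-- The hyperplane `x_j = c`. -/
def coordHyperplane {d : ℕ} (j : Fin d) (c : ℝ) : AffineHyperplane d :=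
  ⟨{x | x j = c}, Pi.single j 1, by simp, c, by ext x; simp [Pi.single_apply]⟩

/-- For `d ≥ 1` there are `k`-covers, so the minimum defining `f(n,d,k)` is over a nonempty
set of natural numbers. -/
theorem exists_isKCover (n d k : ℕ) (hd : 1 ≤ d) :
    ∃ C : Multiset (AffineHyperplane d), IsKCover n d k C := by
  classical
  let j : Fin d := ⟨0, hd⟩
  refine ⟨k • (Multiset.range n).map (fun m : ℕ => coordHyperplane j (m : ℝ)), ?_⟩
  rintro p ⟨x, hx, rfl⟩
  have hj : x j < n := by
    have := Finset.single_le_sum (f := x) (fun i _ => Nat.zero_le _) (Finset.mem_univ j)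
    omega
  rw [Multiset.filter_nsmul, Multiset.card_nsmul]
  refine Nat.le_mul_of_pos_right k (Multiset.card_pos_iff_exists_mem.2
    ⟨coordHyperplane j (x j : ℝ), ?_⟩)
  rw [Multiset.mem_filter]
  exact ⟨Multiset.mem_map.2 ⟨x j, by simpa using hj, rfl⟩, rfl⟩

/-- For `d ≥ 1` there are fractional covers of finite total weight. -/
theorem fracCoverENN_ne_top (n d : ℕ) (hd : 1 ≤ d) : fracCoverENN n d ≠ ⊤ := by
  classical
  let j : Fin d := ⟨0, hd⟩
  let s : Finset (AffineHyperplane d) :=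
    (Finset.range n).image (fun m : ℕ => coordHyperplane j (m : ℝ))
  let w : AffineHyperplane d → ℝ≥0 := fun H => if H ∈ s then 1 else 0
  have hw : IsFractionalCover n d w := by
    rintro p ⟨x, hx, rfl⟩
    have hj : x j < n := by
      have := Finset.single_le_sum (f := x) (fun i _ => Nat.zero_le _) (Finset.mem_univ j)
      omega
    have hs : coordHyperplane j (x j : ℝ) ∈ s :=
      Finset.mem_image.2 ⟨x j, Finset.mem_range.2 hj, rfl⟩
    refine le_trans ?_ (ENNReal.le_tsum ⟨coordHyperplane j (x j : ℝ), rfl⟩)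
    simp [w, hs]
  have hle : fracCoverENN n d ≤ ∑' H : AffineHyperplane d, (w H : ℝ≥0∞) :=
    iInf₂_le w hw
  have hsum : ∑' H : AffineHyperplane d, (w H : ℝ≥0∞) = ∑ H ∈ s, (w H : ℝ≥0∞) :=
    tsum_eq_sum (fun H hH => by simp [w, hH])
  refine ne_top_of_le_ne_top ?_ hle
  rw [hsum]
  exact ENNReal.sum_ne_top.2 (fun H _ => ENNReal.coe_ne_top)

/-! Write k = N + 1 and use barycentric coordinates, so that the points of T_2(N + 1) are the
triples a + b + c = N. For m and Q = 3m - N > 0, giving weight (m - i)/Q to the line at level i < m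
in each of the three coordinate directions is a fractional cover of cost 3m(m + 1)/(2Q). The proof
shows that a suitable m makes this cost a lower bound for the fractional optimum, and that the same
profile, stretched to T_2(n), gives an integral cover with bounded rounding loss.

Lower bound (`exists_le_fracCoverNumber`): by weak duality it suffices to weight the points so that
no line exceeds D. `hexWeight` is three times the largest deviation of a coordinate from N/3, hence
constant on concentric hexagons. It is cut off at max = m, where a correction e depending on N mod 3
makes all coordinate lines of level below m weigh exactly D. Any other line is sparse by
`line_trichotomy`: its points are at least 2 apart in some coordinate, so crude bounds suffice.

Upper bound (`kCoverNumber_le`): in each direction take the line at level c once for every j in [1,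
m] with cQ ≤ jn. The multiplicities at a point are at least m - cQ/n, and the three levels sum to n
- 1, so they add up to more than 3m - Q = N. Rounding costs at most 3m lines. -/

/-! ### Linear programming duality. -/

/-- The point of the plane with natural coordinates `p`. -/
def latticePoint (p : ℕ × ℕ) : Fin 2 → ℝ := fun i => ((![p.1, p.2] i : ℕ) : ℝ)

theorem latticePoint_mem_triGrid {n : ℕ} {p : ℕ × ℕ} (h : p.1 + p.2 + 1 ≤ n) :
    latticePoint p ∈ triGrid 2 n :=
  ⟨![p.1, p.2], by simpa [Fin.sum_univ_two] using h, rfl⟩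

open Classical in
/-- Weak linear programming duality: a weighting of grid points that puts weight at most `D` on
every line bounds the fractional cover number from below. -/
theorem sum_weight_le_mul_fracCoverENN {n : ℕ} (T : Finset (ℕ × ℕ))
    (hT : ∀ p ∈ T, p.1 + p.2 + 1 ≤ n) (W : ℕ × ℕ → ℕ) (D : ℕ) (hD0 : D ≠ 0)
    (hD : ∀ H : AffineHyperplane 2, ∑ p ∈ T with latticePoint p ∈ H.1, W p ≤ D) :
    ((∑ p ∈ T, W p : ℕ) : ℝ≥0∞) ≤ D * fracCoverENN n 2 := by
  have hD0' : (D : ℝ≥0∞) ≠ 0 := by exact_mod_cast hD0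
  have hDt : (D : ℝ≥0∞) ≠ ⊤ := ENNReal.natCast_ne_top D
  rw [fracCoverENN, ENNReal.mul_iInf_of_ne hD0' hDt]
  refine le_iInf fun w => ?_
  rw [ENNReal.mul_iInf_of_ne hD0' hDt]
  refine le_iInf fun hw => ?_
  calc ((∑ p ∈ T, W p : ℕ) : ℝ≥0∞) = ∑ p ∈ T, (W p : ℝ≥0∞) := by push_cast; rfl
    _ ≤ ∑ p ∈ T, ∑' H : AffineHyperplane 2,
          (if latticePoint p ∈ H.1 then (W p : ℝ≥0∞) else 0) * w H := by
        refine Finset.sum_le_sum fun p hp => ?_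
        have h1 := hw _ (latticePoint_mem_triGrid (hT p hp))
        replace h1 := h1.trans_eq (tsum_subtype {H : AffineHyperplane 2 | latticePoint p ∈ H.1}
          (fun H => (w H : ℝ≥0∞)))
        calc (W p : ℝ≥0∞) = W p * 1 := by simp
          _ ≤ _ := mul_le_mul_right h1 _
          _ = _ := by
            rw [← ENNReal.tsum_mul_left]
            refine tsum_congr fun H => ?_
            by_cases h : latticePoint p ∈ H.1 <;> simp [Set.indicator, h]
    _ = ∑' H : AffineHyperplane 2,
          (∑ p ∈ T, if latticePoint p ∈ H.1 then (W p : ℝ≥0∞) else 0) * w H := by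
        rw [← Summable.tsum_finsetSum fun _ _ => ENNReal.summable]
        simp_rw [Finset.sum_mul]
    _ ≤ ∑' H : AffineHyperplane 2, (D : ℝ≥0∞) * w H := by
        refine ENNReal.tsum_le_tsum fun H => mul_le_mul_left ?_ _
        rw [← Finset.sum_filter]
        exact_mod_cast hD H
    _ = _ := ENNReal.tsum_mul_left

/-! ### Lattice points on a line. -/

theorem two_le_abs_add {x y : ℤ} (h : 0 < x * y) : 2 ≤ |x + y| := by
  rcases pos_and_pos_or_neg_and_neg_of_mul_pos h with ⟨hx, hy⟩ | ⟨hx, hy⟩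
  · rw [abs_of_pos] <;> omega
  · rw [abs_of_neg] <;> omega

theorem mul_pos_of_linear_relation {α β : ℝ} {x y : ℤ} (h : α * x + β * y = 0)
    (hαβ : α * β < 0) (hxy : x ≠ 0 ∨ y ≠ 0) : 0 < x * y := by
  have hα : α ≠ 0 := fun h => by simp [h] at hαβ
  have hβ : β ≠ 0 := fun h => by simp [h] at hαβ
  have hy : y ≠ 0 := by
    rintro rfl
    simp [hα] at h
    simp [h] at hxy
  have hy' : 0 < (β * y) ^ 2 := by positivity
  have e : (α * β) * ((x : ℝ) * y) = -(β * y) ^ 2 := by linear_combination β * y * h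
  have : 0 < ((x * y : ℤ) : ℝ) := by
    push_cast
    by_contra! hc
    nlinarith [mul_nonneg_of_nonpos_of_nonpos hαβ.le hc]
  exact_mod_cast this

/-- The points of `T_2(N + 1)` on a line either share one of the three barycentric coordinates,
or have pairwise distances at least two in one of them. -/
theorem line_trichotomy (H : AffineHyperplane 2) :
    ((∀ p q : ℕ × ℕ, latticePoint p ∈ H.1 → latticePoint q ∈ H.1 → p.1 = q.1) ∨
     (∀ p q : ℕ × ℕ, latticePoint p ∈ H.1 → latticePoint q ∈ H.1 → p.2 = q.2) ∨
     (∀ p q : ℕ × ℕ, latticePoint p ∈ H.1 → latticePoint q ∈ H.1 → p.1 + p.2 = q.1 + q.2)) ∨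
    ((∀ p q : ℕ × ℕ, latticePoint p ∈ H.1 → latticePoint q ∈ H.1 → p ≠ q →
        2 ≤ |(p.1 : ℤ) - q.1|) ∨
     (∀ p q : ℕ × ℕ, latticePoint p ∈ H.1 → latticePoint q ∈ H.1 → p ≠ q →
        2 ≤ |(p.2 : ℤ) - q.2|) ∨
     (∀ p q : ℕ × ℕ, latticePoint p ∈ H.1 → latticePoint q ∈ H.1 → p ≠ q →
        2 ≤ |((p.1 : ℤ) - q.1) + (p.2 - q.2)|)) := by
  obtain ⟨_, a, ha, c, rfl⟩ := H
  have key : ∀ p q : ℕ × ℕ, latticePoint p ∈ {x : Fin 2 → ℝ | ∑ i, a i * x i = c} →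
      latticePoint q ∈ {x : Fin 2 → ℝ | ∑ i, a i * x i = c} →
      a 0 * (((p.1 : ℤ) - q.1 : ℤ) : ℝ) + a 1 * (((p.2 : ℤ) - q.2 : ℤ) : ℝ) = 0 := by
    intro p q hp hq
    simp only [Set.mem_ofPred_eq, Fin.sum_univ_two, latticePoint, Matrix.cons_val_zero,
      Matrix.cons_val_one] at hp hq
    push_cast
    linarith
  have hne : ∀ p q : ℕ × ℕ, p ≠ q → ((p.1 : ℤ) - q.1 ≠ 0 ∨ (p.2 : ℤ) - q.2 ≠ 0) := by
    intro p q h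
    by_contra! h'
    exact h (Prod.ext (by omega) (by omega))
  by_cases h0 : a 0 = 0
  · have h1 : a 1 ≠ 0 := fun h1 => ha (by ext i; fin_cases i <;> simp [h0, h1])
    refine Or.inl (Or.inr (Or.inl fun p q hp hq => ?_))
    have := key p q hp hq
    simp only [h0, zero_mul, zero_add, mul_eq_zero, h1, false_or, Int.cast_eq_zero] at this
    omega
  by_cases h1 : a 1 = 0
  · refine Or.inl (Or.inl fun p q hp hq => ?_)
    have := key p q hp hq
    simp only [h1, zero_mul, add_zero, mul_eq_zero, h0, false_or, Int.cast_eq_zero] at this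
    omega
  by_cases h2 : a 0 = a 1
  · refine Or.inl (Or.inr (Or.inr fun p q hp hq => ?_))
    have := key p q hp hq
    rw [h2, ← mul_add, ← Int.cast_add] at this
    simp only [mul_eq_zero, h1, false_or, Int.cast_eq_zero] at this
    omega
  have h2' : a 0 - a 1 ≠ 0 := sub_ne_zero.2 h2
  refine Or.inr ?_
  -- The three coordinate differences sum to zero and none vanishes, so two share a sign and the
  -- third has absolute value at least 2. Which two is decided by the signs of the coefficients,
  -- hence is the same for all pairs on the line.
  rcases lt_or_gt_of_ne (mul_ne_zero h0 h1) with h | h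
  · exact Or.inr (Or.inr fun p q hp hq hpq => two_le_abs_add
      (mul_pos_of_linear_relation (key p q hp hq) h (hne p q hpq)))
  · rcases lt_or_gt_of_ne (mul_ne_zero h0 h2') with h' | h'
    · refine Or.inl fun p q hp hq hpq => ?_
      have e := key p q hp hq
      have hn := hne p q hpq
      set x := (p.1 : ℤ) - q.1
      set y := (p.2 : ℤ) - q.2
      have := two_le_abs_add (mul_pos_of_linear_relation (x := x + y) (y := -y)
        (by push_cast; linear_combination e) h' (by omega))
      simpa using this
    · refine Or.inr (Or.inl fun p q hp hq hpq => ?_)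
      have e := key p q hp hq
      have hn := hne p q hpq
      set x := (p.1 : ℤ) - q.1
      set y := (p.2 : ℤ) - q.2
      have hs : a 1 * (a 1 - a 0) < 0 := by
        have h3 : 0 < a 0 ^ 2 := by positivity
        by_contra! hc
        nlinarith [mul_pos h h', mul_nonneg h3.le hc]
      have := two_le_abs_add (mul_pos_of_linear_relation (x := x + y) (y := -x)
        (by push_cast; linear_combination e) hs (by omega))
      simpa using this

/-! ### The hexagonal weight and its sums along coordinate lines. -/

/-- The dual weight of the point with barycentric coordinates `a + b + c = N`. -/
def hexWeight (N m e a b c : ℕ) : ℕ :=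
  if m < max a (max b c) then 0
  else if max a (max b c) = m then e
  else max (3 * max a (max b c) - N) (N - 3 * min a (min b c))

theorem hexWeight_comm_right (N m e a b c : ℕ) : hexWeight N m e a b c = hexWeight N m e a c b := by
  simp only [hexWeight, max_comm b c, min_comm b c]

theorem hexWeight_comm_left (N m e a b c : ℕ) : hexWeight N m e a b c = hexWeight N m e b a c := by
  simp only [hexWeight, max_left_comm a b c, min_left_comm a b c]

theorem hexWeight_of_lt {N m e a b c : ℕ} (h : m < a) : hexWeight N m e a b c = 0 := by
  rw [hexWeight, if_pos (lt_max_of_lt_left h)]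

/-- The weight of the line `a = s`. -/
def lineWeight (N m e s : ℕ) : ℕ := ∑ b ∈ Finset.range (N - s + 1), hexWeight N m e s b (N - s - b)

theorem lineWeight_of_lt {N m e s : ℕ} (h : m < s) : lineWeight N m e s = 0 :=
  Finset.sum_eq_zero fun _ _ => hexWeight_of_lt h

/-- Summation of a palindromic function with a constant middle block. -/
theorem sum_range_palindrome {f g : ℕ → ℕ} {M P R K : ℕ} (hM : M = P + R + P)
    (h₁ : ∀ b < P, f b = g b) (h₂ : ∀ b < R, f (P + b) = K)
    (h₃ : ∀ b < P, f (M - 1 - b) = g b) :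
    ∑ b ∈ Finset.range M, f b = 2 * ∑ b ∈ Finset.range P, g b + R * K := by
  subst hM
  have h : ∑ b ∈ Finset.range P, f (P + R + (P - 1 - b)) = ∑ b ∈ Finset.range P, g b := by
    refine Finset.sum_congr rfl fun b hb => ?_
    have := Finset.mem_range.1 hb
    rw [← h₃ b this]
    congr 1
    omega
  rw [Finset.sum_range_add, Finset.sum_range_add,
    Finset.sum_congr rfl fun b hb => h₁ b (Finset.mem_range.1 hb),
    Finset.sum_congr rfl fun b hb => h₂ b (Finset.mem_range.1 hb),
    ← Finset.sum_range_reflect (fun b => f (P + R + b)) P, h, Finset.sum_const,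
    Finset.card_range, smul_eq_mul]
  ring

/-- Doubling and moving 3d to the left avoid division and subtraction in ℕ. -/
theorem two_mul_sum_arith (x d : ℕ) :
    2 * ∑ b ∈ Finset.range d, (x + 3 * (d - 1 - b)) + 3 * d = 2 * d * x + 3 * d * d := by
  rw [Finset.sum_range_reflect (fun b => x + 3 * b) d]
  induction d with
  | zero => simp
  | succ d ih => rw [Finset.sum_range_succ]; linarith

theorem sum_range_trapezoid {f : ℕ → ℕ} {M d R K x : ℕ} (hM : M = d + R + d)
    (h₁ : ∀ b < d, f b = x + 3 * (d - 1 - b)) (h₂ : ∀ b < R, f (d + b) = K)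
    (h₃ : ∀ b < d, f (M - 1 - b) = f b) :
    ∑ b ∈ Finset.range M, f b + 3 * d = 2 * d * x + 3 * d * d + R * K := by
  rw [sum_range_palindrome hM h₁ h₂ fun b hb => (h₃ b hb).trans (h₁ b hb),
    ← two_mul_sum_arith]
  ring

theorem sum_range_trapezoid_padded {f : ℕ → ℕ} {M Z e d R K x : ℕ}
    (hM : M = (Z + 1 + d) + R + (Z + 1 + d)) (h₀ : ∀ b < Z, f b = 0) (he : f Z = e)
    (h₁ : ∀ b < d, f (Z + 1 + b) = x + 3 * (d - 1 - b)) (h₂ : ∀ b < R, f (Z + 1 + d + b) = K)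
    (h₃ : ∀ b < Z + 1 + d, f (M - 1 - b) = f b) :
    ∑ b ∈ Finset.range M, f b + 3 * d = 2 * e + 2 * d * x + 3 * d * d + R * K := by
  rw [sum_range_palindrome hM (fun _ _ => rfl) h₂ h₃, Finset.sum_range_add,
    Finset.sum_range_succ, Finset.sum_eq_zero fun b hb => h₀ b (Finset.mem_range.1 hb), he,
    Finset.sum_congr rfl fun b hb => h₁ b (Finset.mem_range.1 hb)]
  linarith [two_mul_sum_arith x d]

theorem hexWeight_reflect {N m e s b : ℕ} (hb : b ≤ N - s) :
    hexWeight N m e s (N - s + 1 - 1 - b) (N - s - (N - s + 1 - 1 - b)) =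
      hexWeight N m e s b (N - s - b) := by
  rw [hexWeight_comm_right]
  congr 1
  omega

/-- Profile of a line that stays inside the hexagon: slopes of step 3 on both sides, where the
smallest coordinate governs the weight, and a plateau where s does. -/
theorem lineWeight_high {N m e s d R K x : ℕ} (hM : N - s + 1 = d + R + d)
    (h₁ : ∀ b < d, hexWeight N m e s b (N - s - b) = x + 3 * (d - 1 - b))
    (h₂ : ∀ b < R, hexWeight N m e s (d + b) (N - s - (d + b)) = K) :
    lineWeight N m e s + 3 * d = 2 * d * x + 3 * d * d + R * K :=
  sum_range_trapezoid hM h₁ h₂ fun _ _ => hexWeight_reflect (by omega)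

/-- Profile of a line that leaves the hexagon: at each end Z zeros and one boundary point of weight
e', then slopes governed by the largest coordinate and a plateau governed by s. -/
theorem lineWeight_low {N m e s Z e' d R K x : ℕ}
    (hM : N - s + 1 = (Z + 1 + d) + R + (Z + 1 + d))
    (h₀ : ∀ b < Z, hexWeight N m e s b (N - s - b) = 0)
    (he : hexWeight N m e s Z (N - s - Z) = e')
    (h₁ : ∀ b < d, hexWeight N m e s (Z + 1 + b) (N - s - (Z + 1 + b)) = x + 3 * (d - 1 - b))
    (h₂ : ∀ b < R, hexWeight N m e s (Z + 1 + d + b) (N - s - (Z + 1 + d + b)) = K) :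
    lineWeight N m e s + 3 * d = 2 * e' + 2 * d * x + 3 * d * d + R * K :=
  sum_range_trapezoid_padded hM h₀ he h₁ h₂ fun _ _ => hexWeight_reflect (by omega)

/-- The sum does not depend on s: this is complementary slackness with the primal cover, whose
weight is positive exactly on levels below m. The same holds in the other two residue classes, with
their own m and e. -/
theorem lineWeight_mod_zero {t s : ℕ} (hs : s < 2 * t + 1) :
    lineWeight (3 * t) (2 * t + 1) 0 s = 3 * t * (t + 1) := by
  rcases le_or_gt t s with h | h
  · obtain ⟨i, rfl⟩ := Nat.exists_eq_add_of_le h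
    obtain ⟨d, rfl⟩ := Nat.exists_eq_add_of_le (show i ≤ t by omega)
    have := lineWeight_high (N := 3 * (i + d)) (m := 2 * (i + d) + 1) (e := 0) (s := i + d + i)
      (d := d) (R := i + 1) (K := 3 * i) (x := 3 * i + 3) (by omega)
      (fun b hb => by unfold hexWeight; split_ifs <;> omega)
      (fun b hb => by unfold hexWeight; split_ifs <;> omega)
    linarith
  · obtain ⟨i, rfl⟩ := Nat.exists_eq_add_of_le (show s + 1 ≤ t by omega)
    have := lineWeight_low (N := 3 * (s + 1 + i)) (m := 2 * (s + 1 + i) + 1) (e := 0) (s := s)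
      (Z := i) (e' := 0) (d := s) (R := i + 2) (K := 3 * i + 3) (x := 3 * i + 6) (by omega)
      (fun b hb => by unfold hexWeight; split_ifs <;> omega)
      (by unfold hexWeight; split_ifs <;> omega)
      (fun b hb => by unfold hexWeight; split_ifs <;> omega)
      (fun b hb => by unfold hexWeight; split_ifs <;> omega)
    linarith

theorem lineWeight_mod_one {t s : ℕ} (hs : s < 2 * t + 1) :
    lineWeight (3 * t + 1) (2 * t + 1) (2 * t + 1) s = (t + 1) * (3 * t + 2) := by
  rcases lt_or_ge t s with h | h
  · obtain ⟨i, rfl⟩ := Nat.exists_eq_add_of_le (show t + 1 ≤ s by omega)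
    obtain ⟨d, rfl⟩ := Nat.exists_eq_add_of_le (show i ≤ t by omega)
    have := lineWeight_high (N := 3 * (i + d) + 1) (m := 2 * (i + d) + 1) (e := 2 * (i + d) + 1)
      (s := i + d + 1 + i)
      (d := d) (R := i + 1) (K := 3 * i + 2) (x := 3 * i + 4) (by omega)
      (fun b hb => by unfold hexWeight; split_ifs <;> omega)
      (fun b hb => by unfold hexWeight; split_ifs <;> omega)
    linarith
  · obtain ⟨i, rfl⟩ := Nat.exists_eq_add_of_le h
    have := lineWeight_low (N := 3 * (s + i) + 1) (m := 2 * (s + i) + 1) (e := 2 * (s + i) + 1)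
      (s := s) (Z := i) (e' := 2 * (s + i) + 1) (d := s) (R := i) (K := 3 * i + 1)
      (x := 3 * i + 2) (by omega)
      (fun b hb => by unfold hexWeight; split_ifs <;> omega)
      (by unfold hexWeight; split_ifs <;> omega)
      (fun b hb => by unfold hexWeight; split_ifs <;> omega)
      (fun b hb => by unfold hexWeight; split_ifs <;> omega)
    linarith

theorem lineWeight_mod_two {t s : ℕ} (hs : s < 2 * t + 2) :
    lineWeight (3 * t + 2) (2 * t + 2) (t + 1) s = (t + 1) * (3 * t + 4) := by
  rcases lt_or_ge t s with h | h
  · obtain ⟨i, rfl⟩ := Nat.exists_eq_add_of_le (show t + 1 ≤ s by omega)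
    obtain ⟨d, rfl⟩ := Nat.exists_eq_add_of_le (show i ≤ t by omega)
    have := lineWeight_high (N := 3 * (i + d) + 2) (m := 2 * (i + d) + 2) (e := i + d + 1)
      (s := i + d + 1 + i)
      (d := d + 1) (R := i) (K := 3 * i + 1) (x := 3 * i + 2) (by omega)
      (fun b hb => by unfold hexWeight; split_ifs <;> omega)
      (fun b hb => by unfold hexWeight; split_ifs <;> omega)
    linarith
  · obtain ⟨i, rfl⟩ := Nat.exists_eq_add_of_le h
    have := lineWeight_low (N := 3 * (s + i) + 2) (m := 2 * (s + i) + 2) (e := s + i + 1)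
      (s := s) (Z := i) (e' := s + i + 1) (d := s) (R := i + 1) (K := 3 * i + 2)
      (x := 3 * i + 4) (by omega)
      (fun b hb => by unfold hexWeight; split_ifs <;> omega)
      (by unfold hexWeight; split_ifs <;> omega)
      (fun b hb => by unfold hexWeight; split_ifs <;> omega)
      (fun b hb => by unfold hexWeight; split_ifs <;> omega)
    linarith

theorem lineWeight_top {N m e : ℕ} (hm : N < 2 * m) :
    lineWeight N m e m = (N - m + 1) * e := by
  rw [lineWeight, Finset.sum_congr rfl (g := fun _ => e)]
  · simp
  · intro b hb
    have := Finset.mem_range.1 hb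
    unfold hexWeight
    split_ifs <;> omega

/-! ### Bounding the weight of an arbitrary line. -/

/-- The pairs `(a, b)` with `a + b ≤ N`. -/
def natTriangle (N : ℕ) : Finset (ℕ × ℕ) :=
  (Finset.range (N + 1) ×ˢ Finset.range (N + 1)).filter fun p => p.1 + p.2 ≤ N

theorem mem_natTriangle {N : ℕ} {p : ℕ × ℕ} : p ∈ natTriangle N ↔ p.1 + p.2 ≤ N := by
  simp only [natTriangle, Finset.mem_filter, Finset.mem_product, Finset.mem_range]
  omega

/-- The dual weight as a function on pairs. -/
def pairWeight (N m e : ℕ) (p : ℕ × ℕ) : ℕ := hexWeight N m e p.1 p.2 (N - p.1 - p.2)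

theorem sum_natTriangle (N m e : ℕ) :
    ∑ p ∈ natTriangle N, pairWeight N m e p = ∑ s ∈ Finset.range (N + 1), lineWeight N m e s := by
  rw [natTriangle, Finset.sum_filter, Finset.sum_product]
  refine Finset.sum_congr rfl fun s hs => ?_
  rw [← Finset.sum_filter, lineWeight]
  refine Finset.sum_congr ?_ fun _ _ => rfl
  ext b
  have := Finset.mem_range.1 hs
  simp only [Finset.mem_filter, Finset.mem_range]
  omega

/-- A set of grid points mapped injectively into the points of the line `a = s`. -/
theorem sum_le_lineWeight {N m e s : ℕ} {S : Finset (ℕ × ℕ)} {W : ℕ × ℕ → ℕ} (g : ℕ × ℕ → ℕ)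
    (hg : Set.InjOn g S) (hr : ∀ p ∈ S, g p ≤ N - s)
    (hW : ∀ p ∈ S, W p = hexWeight N m e s (g p) (N - s - g p)) :
    ∑ p ∈ S, W p ≤ lineWeight N m e s := by
  rw [Finset.sum_congr rfl hW,
    ← Finset.sum_image (f := fun b => hexWeight N m e s b (N - s - b)) hg]
  refine Finset.sum_le_sum_of_subset fun b hb => ?_
  obtain ⟨p, hp, rfl⟩ := Finset.mem_image.1 hb
  exact Finset.mem_range.2 (Nat.lt_succ_of_le (hr p hp))

/-- Points separated by at least two in a coordinate `g`. -/
theorem sum_le_of_separated {S : Finset (ℕ × ℕ)} {W g : ℕ × ℕ → ℕ} {t w e : ℕ}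
    (hg : ∀ p ∈ S, ∀ q ∈ S, p ≠ q → 2 ≤ |(g p : ℤ) - g q|)
    (h₁ : ∀ p ∈ S, W p ≤ w) (h₂ : ∀ p ∈ S, 2 * t + 2 ≤ g p → W p ≤ e)
    (h₃ : ∀ p ∈ S, 2 * t + 4 ≤ g p → W p = 0) :
    ∑ p ∈ S, W p ≤ (t + 1) * w + e := by
  -- Separation leaves at most one point in each block {2i, 2i + 1} of values of g; `B` bounds the
  -- weight available in block i.
  let B : ℕ → ℕ := fun i => if i < t + 1 then w else if i = t + 1 then e else 0
  have hinj : Set.InjOn (fun p => g p / 2) S := by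
    intro p hp q hq hpq
    by_contra hne
    have := hg p hp q hq hne
    have h : g p / 2 = g q / 2 := hpq
    rcases le_abs.1 this with h' | h' <;> omega
  calc ∑ p ∈ S, W p ≤ ∑ p ∈ S, B (g p / 2) := by
        refine Finset.sum_le_sum fun p hp => ?_
        simp only [B]
        split_ifs
        · exact h₁ p hp
        · exact h₂ p hp (by omega)
        · exact (h₃ p hp (by omega)).le
    _ = ∑ i ∈ S.image (fun p => g p / 2), B i := (Finset.sum_image hinj).symm
    _ ≤ ∑ i ∈ Finset.range (t + 1 + 1), B i := by
        refine Finset.sum_le_sum_of_ne_zero fun i _ hi => ?_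
        rw [Finset.mem_range]
        by_contra! h
        exact hi (by simp only [B]; split_ifs <;> omega)
    _ = (t + 1) * w + e := by
        rw [Finset.sum_range_succ, Finset.sum_congr rfl (g := fun _ => w)]
        · simp [B]
        · intro i hi
          simp only [B, if_pos (Finset.mem_range.1 hi)]

-- By the symmetry of the weight, a line in a coordinate direction reduces to some a = s. Any other
-- line has at most one point in each of the t + 1 blocks of levels up to 2t + 1, and at most one
-- more of nonzero weight, at level 2t + 2 or 2t + 3.
open Classical in
theorem sum_line_le {N m e D t w e' : ℕ} (hline : ∀ s, lineWeight N m e s ≤ D)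
    (h₁ : ∀ a b c, a + b + c = N → hexWeight N m e a b c ≤ w)
    (h₂ : ∀ a b c, a + b + c = N → 2 * t + 2 ≤ a → hexWeight N m e a b c ≤ e')
    (h₃ : m < 2 * t + 4) (hD : (t + 1) * w + e' ≤ D) (H : AffineHyperplane 2) :
    ∑ p ∈ natTriangle N with latticePoint p ∈ H.1, pairWeight N m e p ≤ D := by
  set S := {p ∈ natTriangle N | latticePoint p ∈ H.1} with hS
  have hmem : ∀ p ∈ S, p.1 + p.2 ≤ N ∧ latticePoint p ∈ H.1 := fun p hp => by
    rwa [hS, Finset.mem_filter, mem_natTriangle] at hp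
  have hcyc : ∀ a b c, hexWeight N m e a b c = hexWeight N m e c a b := fun a b c => by
    rw [hexWeight_comm_right, hexWeight_comm_left]
  rcases S.eq_empty_or_nonempty with h0 | ⟨q, hq⟩
  · simp [h0]
  obtain ⟨hqN, hqH⟩ := hmem q hq
  rcases line_trichotomy H with (h | h | h) | (h | h | h)
  · refine (sum_le_lineWeight (s := q.1) (m := m) (e := e) (N := N) Prod.snd ?_ ?_ ?_).trans
      (hline q.1)
    · exact fun p hp r hr hpr => Prod.ext (h p r (hmem p hp).2 (hmem r hr).2) hpr
    · intro p hp
      have := hmem p hp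
      have := h p q this.2 hqH
      omega
    · intro p hp
      rw [pairWeight, h p q (hmem p hp).2 hqH]
  · refine (sum_le_lineWeight (s := q.2) (m := m) (e := e) (N := N) Prod.fst ?_ ?_ ?_).trans
      (hline q.2)
    · exact fun p hp r hr hpr => Prod.ext hpr (h p r (hmem p hp).2 (hmem r hr).2)
    · intro p hp
      have := hmem p hp
      have := h p q this.2 hqH
      omega
    · intro p hp
      rw [pairWeight, h p q (hmem p hp).2 hqH, hexWeight_comm_left, Nat.sub_right_comm]
  · refine (sum_le_lineWeight (s := N - q.1 - q.2) (m := m) (e := e) (N := N)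
      Prod.fst ?_ ?_ ?_).trans (hline _)
    · intro p hp r hr hpr
      have := h p r (hmem p hp).2 (hmem r hr).2
      have h' : p.1 = r.1 := hpr
      exact Prod.ext h' (by omega)
    · intro p hp
      have := hmem p hp
      have := h p q this.2 hqH
      omega
    · intro p hp
      have := (hmem p hp).1
      have := h p q (hmem p hp).2 hqH
      rw [pairWeight, hcyc]
      congr 1 <;> omega
  · refine (sum_le_of_separated (g := Prod.fst) (t := t) (w := w) (e := e') ?_ ?_ ?_ ?_).trans hD
    · exact fun p hp r hr => h p r (hmem p hp).2 (hmem r hr).2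
    · exact fun p hp => h₁ _ _ _ (by have := hmem p hp; omega)
    · exact fun p hp => h₂ _ _ _ (by have := hmem p hp; omega)
    · exact fun p hp hp' => hexWeight_of_lt (by omega)
  · refine (sum_le_of_separated (g := Prod.snd) (t := t) (w := w) (e := e') ?_ ?_ ?_ ?_).trans hD
    · exact fun p hp r hr => h p r (hmem p hp).2 (hmem r hr).2
    · exact fun p hp => h₁ _ _ _ (by have := hmem p hp; omega)
    · intro p hp hp'
      rw [pairWeight, hexWeight_comm_left]
      exact h₂ _ _ _ (by have := hmem p hp; omega) hp'
    · intro p hp hp'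
      rw [pairWeight, hexWeight_comm_left]
      exact hexWeight_of_lt (by omega)
  · refine (sum_le_of_separated (g := fun p => N - p.1 - p.2) (t := t) (w := w) (e := e')
      ?_ ?_ ?_ ?_).trans hD
    · intro p hp r hr hpr
      have h1 := (hmem p hp).1
      have h2 := (hmem r hr).1
      have h3 := h p r (hmem p hp).2 (hmem r hr).2 hpr
      rw [← abs_neg] at h3
      convert h3 using 2
      omega
    · exact fun p hp => h₁ _ _ _ (by have := hmem p hp; omega)
    · intro p hp hp'
      rw [pairWeight, hcyc]
      exact h₂ _ _ _ (by have := hmem p hp; omega) hp'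
    · intro p hp hp'
      rw [pairWeight, hcyc]
      exact hexWeight_of_lt (by omega)

/-! ### The lower bound for the fractional cover number. -/

theorem le_fracCoverNumber_of_nat {n M D : ℕ}
    (h : (M : ℝ≥0∞) ≤ D * fracCoverENN n 2) : (M : ℝ) ≤ D * fracCoverNumber n 2 := by
  have := ENNReal.toReal_mono
    (ENNReal.mul_ne_top (ENNReal.natCast_ne_top D) (fracCoverENN_ne_top n 2 (by norm_num))) h
  simpa [fracCoverNumber, ENNReal.toReal_mul] using this

/-- Slicing by the first coordinate, the levels below m contribute D each, level m its own sum, and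
higher levels nothing. -/
theorem weight_le_fracCoverNumber {N m e D t w e' : ℕ} (hD0 : D ≠ 0) (hmN : m ≤ N)
    (hline : ∀ s < m, lineWeight N m e s = D) (htop : lineWeight N m e m ≤ D)
    (h₁ : ∀ a b c, a + b + c = N → hexWeight N m e a b c ≤ w)
    (h₂ : ∀ a b c, a + b + c = N → 2 * t + 2 ≤ a → hexWeight N m e a b c ≤ e')
    (h₃ : m < 2 * t + 4) (hD : (t + 1) * w + e' ≤ D) :
    ((m * D + lineWeight N m e m : ℕ) : ℝ) ≤ D * fracCoverNumber (N + 1) 2 := by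
  refine le_fracCoverNumber_of_nat ?_
  have hsum : ∑ p ∈ natTriangle N, pairWeight N m e p = m * D + lineWeight N m e m := by
    obtain ⟨r, rfl⟩ := Nat.exists_eq_add_of_le hmN
    rw [sum_natTriangle, show m + r + 1 = m + 1 + r by ring, Finset.sum_range_add,
      Finset.sum_range_succ, Finset.sum_congr rfl fun s hs => hline s (Finset.mem_range.1 hs),
      Finset.sum_eq_zero (s := Finset.range r) fun s _ => lineWeight_of_lt (by omega)]
    simp
  rw [← hsum]
  refine sum_weight_le_mul_fracCoverENN _ (fun p hp => ?_) _ D hD0 (sum_line_le ?_ h₁ h₂ h₃ hD)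
  · have := mem_natTriangle.1 hp
    omega
  · intro s
    rcases lt_trichotomy s m with h | rfl | h
    · exact (hline s h).le
    · exact htop
    · rw [lineWeight_of_lt h]
      exact Nat.zero_le D

theorem one_le_fracCoverNumber_one : 1 ≤ fracCoverNumber 1 2 := by
  classical
  have := le_fracCoverNumber_of_nat (n := 1) (M := 1) (D := 1) (by
    refine le_trans ?_ (sum_weight_le_mul_fracCoverENN (n := 1) {(0, 0)} (by simp) (fun _ => 1) 1
      one_ne_zero fun H => ?_)
    · simp
    · rw [Finset.sum_const, smul_eq_mul, mul_one]
      exact Finset.card_filter_le _ _)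
  simpa using this

/-- The value of the optimal cover by lines in the three coordinate directions is a lower bound
for the fractional cover number. -/
theorem exists_le_fracCoverNumber (N : ℕ) : ∃ m Q : ℕ, 0 < Q ∧ 3 * m = N + Q ∧
    (3 * m * (m + 1) : ℝ) / (2 * Q) ≤ fracCoverNumber (N + 1) 2 := by
  obtain ⟨t, r, hr, rfl⟩ : ∃ t r, r < 3 ∧ N = 3 * t + r :=
    ⟨N / 3, N % 3, Nat.mod_lt _ (by norm_num), (Nat.div_add_mod N 3).symm⟩
  -- The hypothesis `he` says that the dual value (mD + E)/D equals the primal cost 3m(m + 1)/(2Q).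
  have fin : ∀ {m Q D E : ℕ} {F : ℝ}, 0 < D → 0 < Q → 2 * Q * (m * D + E) = 3 * m * (m + 1) * D →
      ((m * D + E : ℕ) : ℝ) ≤ D * F → (3 * m * (m + 1) : ℝ) / (2 * Q) ≤ F := by
    intro m Q D E F hD hQ he h
    have hD' : (0 : ℝ) < D := by exact_mod_cast hD
    have hQ' : (0 : ℝ) < Q := by exact_mod_cast hQ
    have he' : (2 * Q * (m * D + E) : ℝ) = 3 * m * (m + 1) * D := by exact_mod_cast he
    push_cast at h
    rw [div_le_iff₀ (by positivity)]
    refine le_of_mul_le_mul_right ?_ hD'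
    rw [← he']
    nlinarith
  interval_cases r
  -- For t = 0 the bound D = 3t(t + 1) vanishes, so the one-point grid is treated apart.
  · rcases Nat.eq_zero_or_pos t with rfl | ht
    · refine ⟨1, 3, by norm_num, by norm_num, ?_⟩
      have := one_le_fracCoverNumber_one
      norm_num
      exact this
    · refine ⟨2 * t + 1, 3 * t + 3, by omega, by ring, ?_⟩
      have htop := lineWeight_top (N := 3 * t) (m := 2 * t + 1) (e := 0) (by omega)
      refine fin (D := 3 * t * (t + 1)) (E := 0) (by positivity) (by omega) (by ring) ?_
      have := weight_le_fracCoverNumber (N := 3 * t) (m := 2 * t + 1) (e := 0)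
        (D := 3 * t * (t + 1)) (t := t) (w := 3 * t) (e' := 0) (by positivity) (by omega)
        (fun s hs => lineWeight_mod_zero hs) (by rw [htop]; positivity)
        (fun a b c h => by unfold hexWeight; split_ifs <;> omega)
        (fun a b c h h' => by unfold hexWeight; split_ifs <;> omega) (by omega)
        (by linarith)
      rwa [htop, mul_zero] at this
  · refine ⟨2 * t + 1, 3 * t + 2, by omega, by ring, ?_⟩
    have htop := lineWeight_top (N := 3 * t + 1) (m := 2 * t + 1) (e := 2 * t + 1) (by omega)
    rw [show 3 * t + 1 - (2 * t + 1) + 1 = t + 1 by omega] at htop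
    refine fin (D := (t + 1) * (3 * t + 2)) (E := (t + 1) * (2 * t + 1)) (by positivity)
      (by omega) (by ring) ?_
    rw [← htop]
    exact weight_le_fracCoverNumber (t := t) (w := 3 * t + 1) (e' := 0) (by positivity) (by omega)
      (fun s hs => lineWeight_mod_one hs) (by rw [htop]; gcongr <;> omega)
      (fun a b c h => by unfold hexWeight; split_ifs <;> omega)
      (fun a b c h h' => by unfold hexWeight; split_ifs <;> omega) (by omega)
      (by nlinarith)
  · refine ⟨2 * t + 2, 3 * t + 4, by omega, by ring, ?_⟩
    have htop := lineWeight_top (N := 3 * t + 2) (m := 2 * t + 2) (e := t + 1) (by omega)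
    rw [show 3 * t + 2 - (2 * t + 2) + 1 = t + 1 by omega] at htop
    refine fin (D := (t + 1) * (3 * t + 4)) (E := (t + 1) * (t + 1)) (by positivity)
      (by omega) (by ring) ?_
    rw [← htop]
    exact weight_le_fracCoverNumber (t := t) (w := 3 * t + 2) (e' := t + 1) (by positivity)
      (by omega)
      (fun s hs => lineWeight_mod_two hs) (by rw [htop]; gcongr <;> omega)
      (fun a b c h => by unfold hexWeight; split_ifs <;> omega)
      (fun a b c h h' => by unfold hexWeight; split_ifs <;> omega) (by omega)
      (by nlinarith)

/-! ### The integral cover by threshold families. -/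

/-- The line `x + y = c`. -/
def diagonalLine (c : ℝ) : AffineHyperplane 2 :=
  ⟨{x | x 0 + x 1 = c}, fun _ => 1, fun h => one_ne_zero (congrFun h 0), c, by
    ext x; simp [Fin.sum_univ_two]⟩

/-- In a family of parallel lines `g 0, g 1, …`, the line `g c` taken once for each `j ∈ [1, m]`
with `c * Q ≤ j * n`. -/
def thresholdLines (g : ℕ → AffineHyperplane 2) (m n Q : ℕ) : Multiset (AffineHyperplane 2) :=
  ∑ j ∈ Finset.Icc 1 m, (Multiset.range (j * n / Q + 1)).map g

theorem card_thresholdLines_le (g : ℕ → AffineHyperplane 2) (m n Q : ℕ) :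
    ((thresholdLines g m n Q).card : ℝ) ≤ m * (m + 1) / (2 * Q) * n + m := by
  have h : ((thresholdLines g m n Q).card : ℝ) ≤ ∑ j ∈ Finset.Icc 1 m, ((j : ℝ) * (n / Q) + 1) := by
    rw [thresholdLines, Multiset.card_sum, Nat.cast_sum]
    refine Finset.sum_le_sum fun j _ => ?_
    simp only [Multiset.card_map, Multiset.card_range]
    push_cast
    have := @Nat.cast_div_le ℝ _ _ _ (j * n) Q
    push_cast at this
    rw [← mul_div_assoc]
    linarith
  have gauss : ∀ m : ℕ, ∑ j ∈ Finset.Icc 1 m, (j : ℝ) = m * (m + 1) / 2 := by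
    intro m
    induction m with
    | zero => simp
    | succ m ih => rw [Finset.sum_Icc_succ_top (by omega), ih]; push_cast; ring
  rw [Finset.sum_add_distrib, ← Finset.sum_mul, gauss] at h
  refine h.trans (le_of_eq ?_)
  simp only [Finset.sum_const, Nat.card_Icc, nsmul_eq_mul]
  simp only [div_eq_mul_inv, mul_inv]
  simp
  ring

open Classical in
/-- The number `A` of members of the family through a point of level `x` satisfies
`(m - A) n ≤ x Q`. -/
theorem le_card_thresholdLines {g : ℕ → AffineHyperplane 2} {m n Q x : ℕ} (hQ : 0 < Q)
    {p : Fin 2 → ℝ} (hp : p ∈ (g x).1) :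
    m * n ≤ x * Q + ((thresholdLines g m n Q).filter (fun H => p ∈ H.1)).card * n := by
  have hcard : ((Finset.Icc 1 m).filter fun j => x * Q ≤ j * n).card ≤
      ((thresholdLines g m n Q).filter (fun H => p ∈ H.1)).card := by
    rw [← Multiset.countP_eq_card_filter, thresholdLines, Finset.card_filter]
    rw [← Multiset.coe_countPAddMonoidHom, map_sum]
    refine Finset.sum_le_sum fun j _ => ?_
    split_ifs with h
    · rw [Multiset.coe_countPAddMonoidHom]
      refine Multiset.countP_pos.2 ⟨g x, Multiset.mem_map.2 ⟨x, ?_, rfl⟩, hp⟩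
      rw [Multiset.mem_range, Nat.lt_succ_iff, Nat.le_div_iff_mul_le hQ]
      exact h
    · exact Nat.zero_le _
  refine le_trans ?_ (Nat.add_le_add_left (Nat.mul_le_mul_right n hcard) _)
  by_contra! hc
  set A := ((Finset.Icc 1 m).filter fun j => x * Q ≤ j * n).card with hA
  have hAm : A < m := by
    by_contra! h
    have := Nat.mul_le_mul_right n h
    omega
  -- Here d + 1 = m - A. If (d + 1)n exceeded xQ, all of j = d + 1, …, m would count, which is A + 1
  -- values.
  obtain ⟨d, hd⟩ := Nat.exists_eq_add_of_lt hAm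
  have hmn : m * n = (A + d + 1) * n := by rw [hd]
  have hsub : Finset.Icc (d + 1) m ⊆ (Finset.Icc 1 m).filter fun j => x * Q ≤ j * n := by
    intro j hj
    obtain ⟨h1, h2⟩ := Finset.mem_Icc.1 hj
    refine Finset.mem_filter.2 ⟨Finset.mem_Icc.2 ⟨by omega, h2⟩, ?_⟩
    have := Nat.mul_le_mul_right n h1
    nlinarith
  have := Finset.card_le_card hsub
  rw [← hA, Nat.card_Icc] at this
  omega

/-- The cover by threshold families in the three coordinate directions. -/
theorem isKCover_thresholdLines {N m Q : ℕ} (hQ : 0 < Q) (h : 3 * m = N + Q) (n : ℕ) :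
    IsKCover n 2 (N + 1) (thresholdLines (fun c => coordHyperplane 0 (c : ℝ)) m n Q +
      thresholdLines (fun c => coordHyperplane 1 (c : ℝ)) m n Q +
      thresholdLines (fun c => diagonalLine ((n : ℝ) - 1 - c)) m n Q) := by
  rintro p ⟨x, hx, rfl⟩
  rw [Fin.sum_univ_two] at hx
  obtain ⟨z, rfl⟩ := Nat.exists_eq_add_of_le hx
  set n := x 0 + x 1 + 1 + z with hn
  have h0 := le_card_thresholdLines (g := fun c => coordHyperplane 0 (c : ℝ)) (m := m) (n := n)
    (x := x 0) hQ (p := fun i => (x i : ℝ)) rfl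
  have h1 := le_card_thresholdLines (g := fun c => coordHyperplane 1 (c : ℝ)) (m := m) (n := n)
    (x := x 1) hQ (p := fun i => (x i : ℝ)) rfl
  have h2 := le_card_thresholdLines (g := fun c => diagonalLine ((n : ℝ) - 1 - c)) (m := m) (n := n)
    (x := z) hQ (p := fun i => (x i : ℝ)) (by
      change (x 0 : ℝ) + x 1 = (n : ℝ) - 1 - z
      rw [hn]; push_cast; ring)
  rw [Multiset.filter_add, Multiset.filter_add, Multiset.card_add, Multiset.card_add]
  have aux : ∀ A B C : ℕ, m * n ≤ x 0 * Q + A * n → m * n ≤ x 1 * Q + B * n →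
      m * n ≤ z * Q + C * n → N + 1 ≤ A + B + C := by
    intro A B C h0 h1 h2
    by_contra! hc
    have h3 : (A + B + C) * n ≤ N * n := Nat.mul_le_mul_right n (by omega)
    have h4 : 3 * m * n = (N + Q) * n := by rw [h]
    -- The levels sum to n - 1, not n; the spare Q > 0 makes the inequality strict and yields N + 1
    -- instead of N.
    have h5 : (x 0 + x 1 + z + 1) * Q = n * Q := by rw [hn]; ring
    nlinarith
  exact aux _ _ _ h0 h1 h2

theorem kCoverNumber_le_card {n d k : ℕ} {C : Multiset (AffineHyperplane d)}
    (hC : IsKCover n d k C) : kCoverNumber n d k ≤ C.card :=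
  Nat.sInf_le ⟨C, hC, rfl⟩

theorem kCoverNumber_le {N m Q : ℕ} (hQ : 0 < Q) (h : 3 * m = N + Q) (n : ℕ) :
    (kCoverNumber n 2 (N + 1) : ℝ) ≤ 3 * m * (m + 1) / (2 * Q) * n + 3 * m := by
  have h1 : (kCoverNumber n 2 (N + 1) : ℝ) ≤ _ :=
    Nat.cast_le.2 (kCoverNumber_le_card (isKCover_thresholdLines hQ h n))
  rw [Multiset.card_add, Multiset.card_add] at h1
  push_cast at h1
  refine h1.trans ((add_le_add (add_le_add (card_thresholdLines_le _ m n Q)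
    (card_thresholdLines_le _ m n Q)) (card_thresholdLines_le _ m n Q)).trans (le_of_eq ?_))
  ring

theorem proposition2p5 (k : ℕ) :
    ∃ C : ℝ, ∀ n : ℕ, (kCoverNumber n 2 k : ℝ) ≤ fracCoverNumber k 2 * (n : ℝ) + C := by
  cases k with
  | zero =>
    refine ⟨0, fun n => ?_⟩
    have h : kCoverNumber n 2 0 ≤ 0 := kCoverNumber_le_card (C := 0) fun _ _ => Nat.zero_le _
    rw [Nat.le_zero.1 h, Nat.cast_zero, add_zero]
    exact mul_nonneg ENNReal.toReal_nonneg n.cast_nonneg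
  | succ N =>
    obtain ⟨m, Q, hQ, hm, hF⟩ := exists_le_fracCoverNumber N
    refine ⟨3 * m, fun n => (kCoverNumber_le hQ hm n).trans ?_⟩
    gcongr
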